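/- Consider a finite set $V$ of at least two parties with local Hilbert spaces $\mathbb{C}^{d_v}$, $v\in V$. For $S\subseteq V$ let $\Gamma_S$ denote the partial transpose on the parties in $S$, and for a state $\rho$ (a positive semidefinite operator of trace one on $\bigotimes_{v\in V}\mathbb{C}^{d_v}$) let $\mathcal N_S(\rho)$ be the sum of the absolute values of the negative eigenvalues of $\rho^{\Gamma_S}$. The GME negativity of $\rho$ is $$\mathcal N(\rho)=\min\Big\{\sum_S p_S\,\mathcal N_S(\rho_S)\;:\;\rho=\sum_S p_S\rho_S,\ p_S\ge 0,\ \rho_S\succeq 0,\ \operatorname{Tr}\rho_S=1\Big\},$$ where $S$ runs over all nontrivial subsets $\emptyset\ne S\ne V$. A state is separable with respect to $S|S^c$ if it is a finite convex combination of product states $\rho_1\otimes\rho_2$ with $\rho_1$ a state of the parties in $S$ and $\rho_2$ a state of the parties in $S^c$; it is biseparable if it is a finite convex combination of states each of which is separable with respect to some bipartition. LOCC protocols consist of finitely many rounds; in each round one party performs a quantum instrument with finitely many outcomes and announces the outcome, each other party applies a quantum channel that may depend on it, and the continuation of the protocol may depend on all outcomes so far; local dimensions may change. The minimum defining $\mathcal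 N(\rho)$ is attained for every state $\rho$, and the following hold. 1. $\mathcal N(\rho)=0$ for every biseparable state $\rho$. 2. If $\Lambda$ is the channel implemented by an LOCC protocol, then for every state $\rho$ the operator $\Lambda(\rho)$ is a state and $\mathcal N(\Lambda(\rho))\le\mathcal N(\rho)$. 3. $\mathcal N$ is a convex function on the set of states. 4. If $|V|=2$, then $\mathcal N(\rho)=\mathcal N_S(\rho)$ for every state $\rho$ and every nontrivial $S$. 5. For every state $\rho$, $\mathcal N(\rho)$ is the minimum of the semidefinite program $$\min_{\tilde\rho_S,\tilde X_S}\ \sum_S\operatorname{Tr}\tilde X_S\quad\text{s.t.}\quad \rho=\sum_S\tilde\rho_S,\quad \tilde\rho_S\succeq0,\quad \tilde X_S\succeq 0,\quad \tilde X_S\succeq-\tilde\rho_S^{\Gamma_S}\quad\forall S,$$ and strong duality holds: $\mathcal N(\rho)$ is also the optimal value of the dual program $$\sup_{W,Q_S}\ -\operatorname{Tr}(W\rho)\quad\text{s.t.}\quad 0\preceq Q_S\preceq\mathbb I,\quad Q_S^{\Gamma_S}\preceq W\quad\forall S.$$ The dual program satisfies Slater's condition, that is, it has a feasible point at which all of its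 inequalities are strict. If $\rho$ is positive definite, the supremum is attained. -/

import Mathlib

open scoped Matrix ComplexOrder BigOperators

noncomputable section

namespace GME

universe u

/-- Labels of the product basis of the `n`-party Hilbert space `⨂ v, ℂ ^ (d v)`. -/
abbrev Cfg {V : Type u} (d : V → ℕ) : Type u := ∀ v : V, Fin (d v)

/-- Operators on `⨂ v, ℂ ^ (d v)`, as matrices in the product basis. -/
abbrev Op {V : Type u} (d : V → ℕ) : Type u := Matrix (Cfg d) (Cfg d) ℂ

/-- Density matrices (quantum states). -/
def IsState {n : Type*} [Fintype n] (ρ : Matrix n n ℂ) : Prop :=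
  ρ.PosSemidef ∧ ρ.trace = 1

/-- The nontrivial subsets `∅ ≠ S ≠ V` of the set of parties; `S` stands for the
bipartition `S | Sᶜ`. -/
abbrev Cut (V : Type u) [Fintype V] : Type u :=
  {S : Finset V // S.Nonempty ∧ S ≠ Finset.univ}

section

variable {V : Type u} [Fintype V] [DecidableEq V] {d : V → ℕ}

/-- The configuration that agrees with `y` on `S` and with `x` outside `S`. -/
def swapOn (S : Finset V) (x y : Cfg d) : Cfg d :=
  fun v => if v ∈ S then y v else x v

/-- Partial transpose `A ^ Γ_S` on the subsystems in `S`. -/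
def ptranspose (S : Finset V) (A : Op d) : Op d :=
  Matrix.of fun x y => A (swapOn S x y) (swapOn S y x)

/-- The partial transpose of a Hermitian operator is Hermitian. -/
theorem ptranspose_isHermitian (S : Finset V) {A : Op d} (hA : A.IsHermitian) :
    (ptranspose S A).IsHermitian := by
  ext x y
  simp only [ptranspose, Matrix.conjTranspose_apply, Matrix.of_apply]
  exact hA.apply _ _

/-- The bipartite negativity `N_S(ρ)`: the absolute sum of the negative eigenvalues of
`ρ ^ Γ_S`, with multiplicity (the value is only meaningful for Hermitian `ρ`). -/
def negativity (S : Finset V) (ρ : Op d) : ℝ :=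
  open scoped Classical in
  if h : (ptranspose S ρ).IsHermitian then
    ∑ i with h.eigenvalues i < 0, |h.eigenvalues i|
  else 0

/-- All values `∑ S, p_S N_S(ρ_S)` over the decompositions `ρ = ∑ S, p_S ρ_S` with
`p_S ≥ 0` and states `ρ_S`, where `S` runs over all nontrivial subsets of the parties. -/
def decompositionValues (ρ : Op d) : Set ℝ :=
  {t | ∃ (p : Cut V → ℝ) (σ : Cut V → Op d),
    ρ = ∑ S, p S • σ S ∧ (∀ S, 0 ≤ p S) ∧ (∀ S, IsState (σ S)) ∧
      t = ∑ S : Cut V, p S * negativity S.1 (σ S)}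

/-- The GME negativity. -/
def gmeNegativity (ρ : Op d) : ℝ := sInf (decompositionValues ρ)

/-- `A ⊗ B` with `A` acting on the parties in `S` and `B` on the other ones. -/
def tensorAcross (S : Finset V)
    (A : Matrix (∀ v : {v // v ∈ S}, Fin (d v)) (∀ v : {v // v ∈ S}, Fin (d v)) ℂ)
    (B : Matrix (∀ v : {v // v ∉ S}, Fin (d v)) (∀ v : {v // v ∉ S}, Fin (d v)) ℂ) : Op d :=
  Matrix.of fun x y => A (fun v => x v) (fun v => y v) * B (fun v => x v) (fun v => y v)

/-- Separability with respect to the bipartition `S | Sᶜ`: a finite mixture of product states. -/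
def IsSeparableAcross (S : Finset V) (ρ : Op d) : Prop :=
  ρ ∈ convexHull ℝ {σ : Op d | ∃ A B, IsState A ∧ IsState B ∧ σ = tensorAcross S A B}

/-- Biseparability: a finite mixture of states each of which is separable with respect to some
bipartition. -/
def IsBiseparable (ρ : Op d) : Prop :=
  ρ ∈ convexHull ℝ {σ : Op d | ∃ S : Cut V, IsSeparableAcross S.1 σ}

/-- `⨂ v, K v` for one operator `K v : ℂ ^ (d v) → ℂ ^ (d' v)` per party. -/
def tensorAll {d' : V → ℕ} (K : ∀ v, Matrix (Fin (d' v)) (Fin (d v)) ℂ) :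
    Matrix (Cfg d') (Cfg d) ℂ :=
  Matrix.of fun x y => ∏ v, K v (x v) (y v)

/-- The tensor product over all parties `v` of the completely positive maps
`X ↦ ∑ a, K v a * X * (K v a)ᴴ`. -/
def localMap {d' : V → ℕ} {r : V → ℕ}
    (K : ∀ v, Fin (r v) → Matrix (Fin (d' v)) (Fin (d v)) ℂ) (ρ : Op d) : Op d' :=
  ∑ a : (∀ v, Fin (r v)),
    tensorAll (fun v => K v (a v)) * ρ * (tensorAll (fun v => K v (a v)))ᴴ

/-- The channels `Op d → Op d'` implemented by LOCC protocols with any finite number of rounds.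
Either the protocol is over, or there is another round: some party `v` performs a quantum
instrument with finitely many outcomes `j` and announces `j`; each other party `w` then performs
a quantum channel that may depend on `j`; and the protocol goes on in a way that may
depend on `j`.  For outcome `j`, the operators `K j v a` are the Kraus operators of the completely
positive map of `v`, and the operators `K j w a` are those of the channel of `w ≠ v`.  Local
dimensions may change in each round and may depend on the outcomes. -/
inductive IsLOCC (d' : V → ℕ) : (d : V → ℕ) → (Op d → Op d') → Prop
  | done : IsLOCC d' d' id
  | round (d : V → ℕ) (v : V) (n : ℕ) (mid : Fin n → V → ℕ) (r : Fin n → V → ℕ)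
      (K : ∀ (j : Fin n) (w : V), Fin (r j w) → Matrix (Fin (mid j w)) (Fin (d w)) ℂ)
      (hinstrument : ∑ j, ∑ a, (K j v a)ᴴ * K j v a = 1)
      (hchannel : ∀ j w, w ≠ v → ∑ a, (K j w a)ᴴ * K j w a = 1)
      (Λ : ∀ j, Op (mid j) → Op d') (hΛ : ∀ j, IsLOCC d' (mid j) (Λ j)) :
      IsLOCC d' d (fun ρ => ∑ j, Λ j (localMap (K j) ρ))

/-- All objective values of the primal semidefinite program
`minimize ∑ S, Tr X_S` subject to `ρ = ∑ S, R_S`, `R_S ≽ 0`, `X_S ≽ 0`, `X_S ≽ - R_S ^ Γ_S`. -/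
def primalValues (ρ : Op d) : Set ℝ :=
  {t | ∃ R X : Cut V → Op d,
    ρ = ∑ S, R S ∧
    (∀ S, (R S).PosSemidef ∧ (X S).PosSemidef ∧ (X S + ptranspose S.1 (R S)).PosSemidef) ∧
      t = ∑ S, (X S).trace.re}

/-- Feasibility for the dual program: `0 ≼ Q_S ≼ 1` and `Q_S ^ Γ_S ≼ W` for all `S`. -/
def DualFeasible (W : Op d) (Q : Cut V → Op d) : Prop :=
  ∀ S : Cut V, (Q S).PosSemidef ∧ (1 - Q S).PosSemidef ∧ (W - ptranspose S.1 (Q S)).PosSemidef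

/-- Strict feasibility for the dual program: all the inequalities hold strictly. -/
def DualStrictlyFeasible (W : Op d) (Q : Cut V → Op d) : Prop :=
  ∀ S : Cut V, (Q S).PosDef ∧ (1 - Q S).PosDef ∧ (W - ptranspose S.1 (Q S)).PosDef

/-- All objective values `- Tr (W ρ)` of the dual program. -/
def dualValues (ρ : Op d) : Set ℝ :=
  {t | ∃ (W : Op d) (Q : Cut V → Op d), DualFeasible W Q ∧ t = - (W * ρ).trace.re}

end

end GME

end

/-! Everything is read off the primal program. By the spectral theorem the negativity of `A` across
`S` is the least trace of `X ≽ 0` with `X + A ^ Γ_S ≽ 0` (`isLeast_sum_neg_eigenvalues`). Absorbing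
the weights `p_S` into the operators, or dividing them out again, identifies the minimum over
decompositions with that of the program (`isLeast_decompositionValues_iff`).

Each property then comes from transporting feasible points. They combine linearly, which gives
convexity. Product states have positive partial transpose, so `X = 0` serves for biseparable states.
For an LOCC map, `Γ_S ∘ Λ ∘ Γ_S` is again LOCC, hence positive and trace preserving, so feasible
points go to feasible points of equal value (`IsLOCC.primalValues_subset`). For two parties the two
cuts differ by a full transposition, which preserves positivity and trace.

Attainment and strong duality both follow from closedness of the cone of right-hand sides
(`isClosed_sdpCone`): the least value lies in a closed slice, and any smaller value is cut off by a
separating functional, whose components form a dual feasible point (`exists_dualFeasible_lt`). For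
positive definite `ρ` the dual superlevel sets are compact. -/

set_option linter.unusedSectionVars false

namespace GME

universe u

/-! ### Positive semidefinite matrices and the trace pairing -/

section Matrices

variable {n : Type*}

theorem posSemidef_real_smul {A : Matrix n n ℂ} (hA : A.PosSemidef) {c : ℝ} (hc : 0 ≤ c) :
    (c • A).PosSemidef :=
  hA.smul hc

variable [Fintype n]

theorem exists_eq_conjTranspose_mul_self {A : Matrix n n ℂ} (hA : A.PosSemidef) :
    ∃ C : Matrix n n ℂ, A = Cᴴ * C := by
  classical
  open scoped MatrixOrder in
  exact CStarAlgebra.nonneg_iff_eq_star_mul_self.mp hA.nonneg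

theorem re_trace_mul_nonneg {A B : Matrix n n ℂ} (hA : A.PosSemidef) (hB : B.PosSemidef) :
    0 ≤ (A * B).trace.re := by
  obtain ⟨C, rfl⟩ := exists_eq_conjTranspose_mul_self hA
  rw [Matrix.mul_assoc, Matrix.trace_mul_comm]
  exact (Complex.nonneg_iff.mp (hB.mul_mul_conjTranspose_same C).trace_nonneg).1

theorem re_trace_nonneg {A : Matrix n n ℂ} (hA : A.PosSemidef) : 0 ≤ A.trace.re :=
  (Complex.nonneg_iff.mp hA.trace_nonneg).1

theorem trace_eq_re {A : Matrix n n ℂ} (hA : A.PosSemidef) : A.trace = (A.trace.re : ℂ) :=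
  Complex.ext rfl (by simpa using (Complex.nonneg_iff.mp hA.trace_nonneg).2.symm)

theorem eq_zero_of_re_trace_eq_zero {A : Matrix n n ℂ} (hA : A.PosSemidef)
    (h : A.trace.re = 0) : A = 0 :=
  hA.trace_eq_zero_iff.mp (by rw [trace_eq_re hA, h, Complex.ofReal_zero])

theorem re_trace_smul (c : ℝ) (A : Matrix n n ℂ) : (c • A).trace.re = c * A.trace.re := by
  simp [Matrix.trace_smul]

theorem re_trace_sum {ι : Type*} [Fintype ι] (A : ι → Matrix n n ℂ) :
    (∑ i, A i).trace.re = ∑ i, (A i).trace.re := by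
  rw [Matrix.trace_sum, Complex.re_sum]

/-- With `A = Cᴴ * C` the trace is the sum of all `‖C k l‖ ^ 2`, and each term of an entry is
bounded by the AM-GM inequality. This makes trace-bounded sets of positive matrices compact. -/
theorem norm_apply_le_re_trace {A : Matrix n n ℂ} (hA : A.PosSemidef) (i j : n) :
    ‖A i j‖ ≤ A.trace.re := by
  obtain ⟨C, rfl⟩ := exists_eq_conjTranspose_mul_self hA
  have h1 : (Cᴴ * C).trace.re = ∑ k, ∑ l, ‖C k l‖ ^ 2 := by
    rw [Matrix.trace, Complex.re_sum, Finset.sum_comm]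
    refine Finset.sum_congr rfl fun l _ => ?_
    rw [Matrix.diag_apply, Matrix.mul_apply, Complex.re_sum]
    refine Finset.sum_congr rfl fun k _ => ?_
    rw [Matrix.conjTranspose_apply, Complex.sq_norm, Complex.normSq_apply]
    simp
  rw [h1, Matrix.mul_apply]
  refine (norm_sum_le _ _).trans (Finset.sum_le_sum fun k _ => ?_)
  have hi : ‖C k i‖ ^ 2 ≤ ∑ l, ‖C k l‖ ^ 2 := Finset.single_le_sum (f := fun l => ‖C k l‖ ^ 2) (fun l _ => by positivity)
    (Finset.mem_univ i)
  have hj : ‖C k j‖ ^ 2 ≤ ∑ l, ‖C k l‖ ^ 2 := Finset.single_le_sum (f := fun l => ‖C k l‖ ^ 2) (fun l _ => by positivity)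
    (Finset.mem_univ j)
  rw [norm_mul, Matrix.conjTranspose_apply, norm_star]
  nlinarith [sq_nonneg (‖C k i‖ - ‖C k j‖)]

theorem isClosed_setOf_posSemidef : IsClosed {A : Matrix n n ℂ | A.PosSemidef} := by
  have h : {A : Matrix n n ℂ | A.PosSemidef} =
      {A | Aᴴ = A} ∩ ⋂ x : n → ℂ, {A | 0 ≤ star x ⬝ᵥ (A *ᵥ x)} := by
    ext A
    simp [Matrix.posSemidef_iff_dotProduct_mulVec, Matrix.IsHermitian]
  rw [h]
  refine (isClosed_eq (by fun_prop) continuous_id).inter (isClosed_iInter fun x => ?_)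
  refine isClosed_Ici.preimage (f := fun A : Matrix n n ℂ => star x ⬝ᵥ (A *ᵥ x)) ?_
  fun_prop

theorem continuous_re_trace : Continuous fun A : Matrix n n ℂ => A.trace.re :=
  Complex.continuous_re.comp (by fun_prop)

theorem isCompact_setOf_norm_apply_le {m k : Type*} (r : ℝ) :
    IsCompact {A : Matrix m k ℂ | ∀ i j, ‖A i j‖ ≤ r} := by
  have h : IsCompact (Set.pi Set.univ fun _ : m => Set.pi Set.univ fun _ : k =>
      Metric.closedBall (0 : ℂ) r) :=
    isCompact_univ_pi fun _ => isCompact_univ_pi fun _ => isCompact_closedBall _ _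
  refine (congrArg IsCompact (Set.ext fun A => ?_)).mp h
  exact ⟨fun h i j => mem_closedBall_zero_iff.mp (h i trivial j trivial),
    fun h i _ j _ => mem_closedBall_zero_iff.mpr (h i j)⟩

theorem isCompact_setOf_posSemidef_trace_le (r : ℝ) :
    IsCompact {A : Matrix n n ℂ | A.PosSemidef ∧ A.trace.re ≤ r} := by
  refine (isCompact_setOf_norm_apply_le r).of_isClosed_subset ?_
    fun A hA i j => (norm_apply_le_re_trace hA.1 i j).trans hA.2
  exact isClosed_setOf_posSemidef.inter (isClosed_Iic.preimage continuous_re_trace)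

/-- Self-duality of the positive cone, tested on rank-one matrices; it turns functionals back into
operator inequalities. -/
theorem posSemidef_of_forall_re_trace_mul_nonneg {A : Matrix n n ℂ} (hA : A.IsHermitian)
    (h : ∀ B : Matrix n n ℂ, B.PosSemidef → 0 ≤ (A * B).trace.re) : A.PosSemidef := by
  refine Matrix.PosSemidef.of_dotProduct_mulVec_nonneg hA fun x => Complex.nonneg_iff.mpr ⟨?_, ?_⟩
  · have := h _ (Matrix.posSemidef_vecMulVec_self_star x)
    rwa [Matrix.mul_vecMulVec, Matrix.trace_vecMulVec, dotProduct_comm] at this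
  · exact (hA.im_star_dotProduct_mulVec_self x).symm

variable [DecidableEq n]

/-- The absolute sum of the negative eigenvalues of a Hermitian matrix `A` is the least trace of a
matrix `X` with `X ≽ 0` and `X ≽ -A`. -/
theorem isLeast_sum_neg_eigenvalues {A : Matrix n n ℂ} (hA : A.IsHermitian) :
    IsLeast {t | ∃ X : Matrix n n ℂ, X.PosSemidef ∧ (X + A).PosSemidef ∧ t = X.trace.re}
      (∑ i with hA.eigenvalues i < 0, |hA.eigenvalues i|) := by
  set U : Matrix n n ℂ := hA.eigenvectorUnitary.1 with hU
  set D : Matrix n n ℂ := Matrix.diagonal fun i => (hA.eigenvalues i : ℂ) with hD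
  have hUU : U * Uᴴ = 1 := Matrix.mem_unitaryGroup_iff.mp hA.eigenvectorUnitary.2
  have hUU' : Uᴴ * U = 1 := Matrix.mem_unitaryGroup_iff'.mp hA.eigenvectorUnitary.2
  have hspec : A = U * D * Uᴴ := hA.spectral_theorem
  have hspec' : Uᴴ * A * U = D := by
    rw [hspec, show Uᴴ * (U * D * Uᴴ) * U = (Uᴴ * U) * D * (Uᴴ * U) by
      simp only [Matrix.mul_assoc], hUU', Matrix.one_mul, Matrix.mul_one]
  have hsum : (∑ i with hA.eigenvalues i < 0, |hA.eigenvalues i|) =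
      ∑ i, max (-hA.eigenvalues i) 0 := by
    rw [Finset.sum_filter]
    refine Finset.sum_congr rfl fun i _ => ?_
    split_ifs with h
    · rw [abs_of_neg h, max_eq_left (by linarith)]
    · rw [max_eq_right (by linarith)]
  rw [hsum]
  constructor
  -- The optimal `X` is the negative part of `A`.
  · refine ⟨U * Matrix.diagonal (fun i => ((max (-hA.eigenvalues i) 0 : ℝ) : ℂ)) * Uᴴ,
      ?_, ?_, ?_⟩
    · refine Matrix.PosSemidef.mul_mul_conjTranspose_same ?_ U
      exact Matrix.PosSemidef.diagonal fun i => by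
        simpa only [Pi.zero_apply, Complex.zero_le_real] using le_max_right _ _
    · have : U * Matrix.diagonal (fun i => ((max (-hA.eigenvalues i) 0 : ℝ) : ℂ)) * Uᴴ + A =
          U * Matrix.diagonal (fun i =>
            ((max (-hA.eigenvalues i) 0 + hA.eigenvalues i : ℝ) : ℂ)) * Uᴴ := by
        refine (congrArg (_ + ·) hspec).trans ?_
        rw [← Matrix.add_mul, ← Matrix.mul_add, hD, Matrix.diagonal_add]
        simp only [Complex.ofReal_add]
      rw [this]
      refine Matrix.PosSemidef.mul_mul_conjTranspose_same ?_ U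
      exact Matrix.PosSemidef.diagonal fun i => by
        simp only [Pi.zero_apply, Complex.zero_le_real]
        linarith [le_max_left (-hA.eigenvalues i) 0]
    · rw [Matrix.trace_mul_comm, ← Matrix.mul_assoc, hUU', Matrix.one_mul, Matrix.trace_diagonal,
        Complex.re_sum]
      simp only [Complex.ofReal_re]
  · rintro _ ⟨X, hX, hXA, rfl⟩
    -- Optimality: in an eigenbasis of `A`, each diagonal entry of `X` is at least `-λ i` and at
    -- least `0`.
    have htr : X.trace = (Uᴴ * X * U).trace := by
      rw [Matrix.trace_mul_comm, ← Matrix.mul_assoc, hUU, Matrix.one_mul]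
    rw [htr, Matrix.trace, Complex.re_sum]
    refine Finset.sum_le_sum fun i _ => max_le ?_ ?_
    · have h := (hXA.conjTranspose_mul_mul_same U).diag_nonneg (i := i)
      rw [Matrix.mul_add, Matrix.add_mul, hspec', Matrix.add_apply, hD,
        Matrix.diagonal_apply_eq] at h
      have h' := (Complex.nonneg_iff.mp h).1
      simp only [Complex.add_re, Complex.ofReal_re] at h'
      rw [Matrix.diag_apply]
      linarith
    · exact (Complex.nonneg_iff.mp (hX.conjTranspose_mul_mul_same U).diag_nonneg).1

/-- Take `c` to be the least eigenvalue, so that `A - c • 1 ≽ 0`. This coercivity is what full rank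
contributes to dual attainment. -/
theorem exists_pos_mul_trace_le {A : Matrix n n ℂ} (hA : A.PosDef) :
    ∃ c : ℝ, 0 < c ∧ ∀ P : Matrix n n ℂ, P.PosSemidef → c * P.trace.re ≤ (P * A).trace.re := by
  rcases isEmpty_or_nonempty n with hn | hn
  · exact ⟨1, one_pos, fun P _ => by simp [Matrix.trace]⟩
  obtain ⟨i₀, hi₀⟩ := Finite.exists_min hA.1.eigenvalues
  refine ⟨hA.1.eigenvalues i₀, hA.eigenvalues_pos i₀, fun P hP => ?_⟩
  have hpsd : (A - hA.1.eigenvalues i₀ • (1 : Matrix n n ℂ)).PosSemidef := by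
    set U : Matrix n n ℂ := hA.1.eigenvectorUnitary.1 with hU
    have hUU : U * Uᴴ = 1 := Matrix.mem_unitaryGroup_iff.mp hA.1.eigenvectorUnitary.2
    have hspec : A = U * Matrix.diagonal (fun i => (hA.1.eigenvalues i : ℂ)) * Uᴴ :=
      hA.1.spectral_theorem
    have : A - hA.1.eigenvalues i₀ • (1 : Matrix n n ℂ) =
        U * Matrix.diagonal (fun i => ((hA.1.eigenvalues i - hA.1.eigenvalues i₀ : ℝ) : ℂ)) *
          Uᴴ := by
      have h2 : Matrix.diagonal
          (fun i => ((hA.1.eigenvalues i - hA.1.eigenvalues i₀ : ℝ) : ℂ)) =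
          Matrix.diagonal (fun i => (hA.1.eigenvalues i : ℂ)) -
            hA.1.eigenvalues i₀ • (1 : Matrix n n ℂ) := by
        ext i j
        by_cases h : i = j <;> simp [h]
      rw [h2, Matrix.mul_sub, Matrix.sub_mul, ← hspec, Matrix.mul_smul, Matrix.smul_mul,
        Matrix.mul_one, hUU]
    rw [this]
    refine Matrix.PosSemidef.mul_mul_conjTranspose_same ?_ U
    exact Matrix.PosSemidef.diagonal fun i => by
      simpa only [Pi.zero_apply, Complex.zero_le_real, sub_nonneg] using hi₀ i
  have h := re_trace_mul_nonneg hP hpsd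
  rw [Matrix.mul_sub, Matrix.trace_sub, Complex.sub_re, Matrix.mul_smul, Matrix.mul_one,
    re_trace_smul] at h
  linarith

/-- Real linear functionals on the Hermitian matrices are of the form `A ↦ Re Tr (W A)` with a
Hermitian matrix `W`. -/
theorem exists_isHermitian_re_trace_mul (f : Matrix n n ℂ →ₗ[ℝ] ℝ) :
    ∃ W : Matrix n n ℂ, W.IsHermitian ∧
      ∀ A : Matrix n n ℂ, A.IsHermitian → f A = (W * A).trace.re := by
  -- `G` records `f` on the real basis of matrix units and their multiples by `I`; on Hermitian
  -- arguments its Hermitian part gives the same values.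
  set G : Matrix n n ℂ := Matrix.of fun j i =>
    (f (Matrix.single i j 1) : ℂ) - Complex.I * (f (Matrix.single i j Complex.I) : ℂ) with hG
  have hf : ∀ A : Matrix n n ℂ, f A = (G * A).trace.re := by
    intro A
    have hsingle : ∀ (i j : n) (z : ℂ), Matrix.single i j z =
        z.re • Matrix.single i j (1 : ℂ) + z.im • Matrix.single i j Complex.I := by
      intro i j z
      rw [Matrix.smul_single, Matrix.smul_single, ← Matrix.single_add]
      congr 1
      simp
    conv_lhs => rw [Matrix.matrix_eq_sum_single A]
    simp only [Matrix.trace, Matrix.diag_apply, Matrix.mul_apply, Complex.re_sum, map_sum]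
    rw [Finset.sum_comm]
    refine Finset.sum_congr rfl fun j _ => Finset.sum_congr rfl fun i _ => ?_
    rw [hsingle, map_add, map_smul, map_smul, hG]
    simp
    ring
  refine ⟨(1 / 2 : ℝ) • (G + Gᴴ), ?_, fun A hA => ?_⟩
  · simp [Matrix.IsHermitian, Matrix.conjTranspose_smul, Matrix.conjTranspose_add, add_comm]
  · have h : (Gᴴ * A).trace.re = (G * A).trace.re := by
      have : (Gᴴ * A).trace = star (G * A).trace := by
        rw [← Matrix.trace_conjTranspose, Matrix.conjTranspose_mul, hA.eq, Matrix.trace_mul_comm]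
      rw [this]
      simp
    rw [hf, Matrix.smul_mul, re_trace_smul, Matrix.add_mul, Matrix.trace_add, Complex.add_re, h]
    ring

end Matrices

/-! ### Partial transposition as a permutation of matrix entries -/

section PartialTranspose

variable {V : Type u} [DecidableEq V] {d : V → ℕ}

theorem swapOn_swapOn (S : Finset V) (x y : Cfg d) :
    swapOn S (swapOn S x y) (swapOn S y x) = x := by
  funext v
  by_cases h : v ∈ S <;> simp [swapOn, h]

theorem swapOn_self (S : Finset V) (x : Cfg d) : swapOn S x x = x := by
  funext v
  simp [swapOn]

/-- Exchanging the entries in `S` of two configurations. -/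
def swapEquiv (S : Finset V) : Cfg d × Cfg d ≃ Cfg d × Cfg d where
  toFun p := (swapOn S p.1 p.2, swapOn S p.2 p.1)
  invFun p := (swapOn S p.1 p.2, swapOn S p.2 p.1)
  left_inv _ := Prod.ext (swapOn_swapOn S _ _) (swapOn_swapOn S _ _)
  right_inv _ := Prod.ext (swapOn_swapOn S _ _) (swapOn_swapOn S _ _)

theorem sum_swapOn [Fintype V] {M : Type*} [AddCommMonoid M] (S : Finset V)
    (f : Cfg d → Cfg d → M) :
    ∑ x, ∑ y, f (swapOn S x y) (swapOn S y x) = ∑ x, ∑ y, f x y := by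
  rw [← Fintype.sum_prod_type', ← Fintype.sum_prod_type']
  exact Fintype.sum_equiv (swapEquiv S) _ _ fun _ => rfl

theorem ptranspose_apply (S : Finset V) (A : Op d) (x y : Cfg d) :
    ptranspose S A x y = A (swapOn S x y) (swapOn S y x) := rfl

theorem ptranspose_zero (S : Finset V) : ptranspose S (0 : Op d) = 0 := rfl

theorem ptranspose_add (S : Finset V) (A B : Op d) :
    ptranspose S (A + B) = ptranspose S A + ptranspose S B := rfl

theorem ptranspose_smul (S : Finset V) (c : ℝ) (A : Op d) :
    ptranspose S (c • A) = c • ptranspose S A := rfl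

theorem continuous_ptranspose (S : Finset V) : Continuous (ptranspose (d := d) S) :=
  continuous_pi fun _ => continuous_pi fun _ => by
    unfold ptranspose
    exact Continuous.matrix_elem continuous_id _ _

theorem ptranspose_sum (S : Finset V) {ι : Type*} (s : Finset ι) (A : ι → Op d) :
    ptranspose S (∑ i ∈ s, A i) = ∑ i ∈ s, ptranspose S (A i) := by
  ext x y
  simp only [ptranspose_apply, Matrix.sum_apply]

variable [Fintype V]

theorem ptranspose_compl (S : Finset V) (A : Op d) :
    ptranspose Sᶜ A = (ptranspose S A)ᵀ := by
  ext x y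
  rw [Matrix.transpose_apply, ptranspose_apply, ptranspose_apply]
  congr 1 <;> funext v <;> by_cases h : v ∈ S <;> simp [swapOn, h]

theorem trace_ptranspose (S : Finset V) (A : Op d) : (ptranspose S A).trace = A.trace := by
  simp only [Matrix.trace, Matrix.diag_apply, ptranspose_apply, swapOn_self]

/-- Reindexing the double sum by the involution `swapEquiv` moves the partial transpose to the other
factor. -/
theorem trace_ptranspose_mul (S : Finset V) (A B : Op d) :
    (ptranspose S A * B).trace = (A * ptranspose S B).trace := by
  simp only [Matrix.trace, Matrix.diag_apply, Matrix.mul_apply]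
  rw [← sum_swapOn S fun x y => A x y * ptranspose S B y x]
  simp only [ptranspose_apply, swapOn_swapOn]

theorem ptranspose_one (S : Finset V) : ptranspose S (1 : Op d) = 1 := by
  ext x y
  rw [ptranspose_apply]
  by_cases h : x = y
  · rw [h, swapOn_self]
  · have h' : swapOn S x y ≠ swapOn S y x := by
      intro he
      apply h
      have h1 := swapOn_swapOn S x y
      have h2 := swapOn_swapOn S y x
      rw [he, swapOn_self] at h1 h2
      exact h1.symm.trans h2
    rw [Matrix.one_apply_ne h, Matrix.one_apply_ne h']

end PartialTranspose

/-! ### Local operations, LOCC and partial transposition -/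

section LocalOperations

variable {V : Type u} [Fintype V] [DecidableEq V] {d d' d'' : V → ℕ}

theorem tensorAll_apply (K : ∀ v, Matrix (Fin (d' v)) (Fin (d v)) ℂ) (x : Cfg d') (y : Cfg d) :
    tensorAll K x y = ∏ v, K v (x v) (y v) := rfl

theorem tensorAll_mul (K : ∀ v, Matrix (Fin (d'' v)) (Fin (d' v)) ℂ)
    (L : ∀ v, Matrix (Fin (d' v)) (Fin (d v)) ℂ) :
    tensorAll K * tensorAll L = tensorAll fun v => K v * L v := by
  ext x y
  simp only [Matrix.mul_apply, tensorAll_apply, Finset.prod_univ_sum, Fintype.piFinset_univ,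
    Finset.prod_mul_distrib]

theorem conjTranspose_tensorAll (K : ∀ v, Matrix (Fin (d' v)) (Fin (d v)) ℂ) :
    (tensorAll K)ᴴ = tensorAll fun v => (K v)ᴴ := by
  ext x y
  simp only [Matrix.conjTranspose_apply, tensorAll_apply, star_prod]

theorem sum_tensorAll {r : V → ℕ} (K : ∀ v, Fin (r v) → Matrix (Fin (d' v)) (Fin (d v)) ℂ) :
    ∑ a : (∀ v, Fin (r v)), tensorAll (fun v => K v (a v)) = tensorAll fun v => ∑ a, K v a := by
  ext x y
  simp only [Matrix.sum_apply, tensorAll_apply, Finset.prod_univ_sum, Fintype.piFinset_univ]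

theorem tensorAll_one : tensorAll (fun v => (1 : Matrix (Fin (d v)) (Fin (d v)) ℂ)) = 1 := by
  ext x y
  rw [tensorAll_apply]
  by_cases h : x = y
  · rw [h, Matrix.one_apply_eq]
    exact Finset.prod_eq_one fun v _ => Matrix.one_apply_eq _
  · obtain ⟨v, hv⟩ := Function.ne_iff.mp h
    rw [Matrix.one_apply_ne h]
    exact Finset.prod_eq_zero (Finset.mem_univ v) (Matrix.one_apply_ne hv)

/-- Only the factor of `v` varies with `j`, so the sum passes into that factor. This gives trace
preservation of a whole round, although single outcomes may lose trace. -/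
theorem sum_tensorAll_eq_one {ι : Type*} [Fintype ι] (v : V)
    (M : ι → ∀ w, Matrix (Fin (d w)) (Fin (d w)) ℂ) (hv : ∑ j, M j v = 1)
    (hw : ∀ j w, w ≠ v → M j w = 1) : ∑ j, tensorAll (M j) = 1 := by
  rw [← tensorAll_one]
  ext x y
  simp only [Matrix.sum_apply, tensorAll_apply]
  rw [← Finset.mul_prod_erase _ _ (Finset.mem_univ v), ← hv, Matrix.sum_apply, Finset.sum_mul]
  refine Finset.sum_congr rfl fun j _ => ?_
  rw [← Finset.mul_prod_erase _ _ (Finset.mem_univ v)]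
  congr 1
  exact Finset.prod_congr rfl fun w h => by rw [hw j w (Finset.ne_of_mem_erase h)]

variable {r : V → ℕ}

theorem localMap_add (K : ∀ v, Fin (r v) → Matrix (Fin (d' v)) (Fin (d v)) ℂ) (A B : Op d) :
    localMap K (A + B) = localMap K A + localMap K B := by
  simp only [localMap, Matrix.mul_add, Matrix.add_mul, Finset.sum_add_distrib]

theorem posSemidef_localMap (K : ∀ v, Fin (r v) → Matrix (Fin (d' v)) (Fin (d v)) ℂ) {A : Op d}
    (hA : A.PosSemidef) : (localMap K A).PosSemidef :=
  Matrix.posSemidef_sum _ fun _ _ => hA.mul_mul_conjTranspose_same _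

theorem trace_localMap (K : ∀ v, Fin (r v) → Matrix (Fin (d' v)) (Fin (d v)) ℂ) (A : Op d) :
    (localMap K A).trace = (tensorAll (fun v => ∑ a, (K v a)ᴴ * K v a) * A).trace := by
  rw [← sum_tensorAll fun v a => (K v a)ᴴ * K v a, localMap, Finset.sum_mul, Matrix.trace_sum,
    Matrix.trace_sum]
  refine Finset.sum_congr rfl fun a _ => ?_
  rw [Matrix.trace_mul_comm, ← Matrix.mul_assoc, conjTranspose_tensorAll, tensorAll_mul]

/-- Complex conjugation of the operators of the parties in `S`. -/
def conjOn (S : Finset V) (K : ∀ v, Fin (r v) → Matrix (Fin (d' v)) (Fin (d v)) ℂ) :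
    ∀ v, Fin (r v) → Matrix (Fin (d' v)) (Fin (d v)) ℂ :=
  fun v a => if v ∈ S then (K v a).map star else K v a

theorem sum_conjOn_eq_one (S : Finset V) {ι : Type*} [Fintype ι] {v : V} {d' r : ι → V → ℕ}
    {K : ∀ j v, Fin (r j v) → Matrix (Fin (d' j v)) (Fin (d v)) ℂ}
    (h : ∑ j, ∑ a, (K j v a)ᴴ * K j v a = 1) :
    ∑ j, ∑ a, (conjOn S (K j) v a)ᴴ * conjOn S (K j) v a = 1 := by
  by_cases hv : v ∈ S
  · simp only [conjOn, hv, if_true]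
    ext x y
    have h' := congrArg (fun A => star (A x y)) h
    simp only [Matrix.sum_apply, Matrix.mul_apply, Matrix.conjTranspose_apply, star_sum,
      star_mul', Matrix.map_apply] at h' ⊢
    rw [h', Matrix.one_apply, apply_ite star, star_one, star_zero]
  · simpa only [conjOn, hv, if_false] using h

/-- For `v ∈ S`, swapping row and column indices interchanges the entry of `K v a` and that of its
conjugate, which amounts to using the conjugated Kraus operator. -/
theorem ptranspose_localMap (S : Finset V)
    (K : ∀ v, Fin (r v) → Matrix (Fin (d' v)) (Fin (d v)) ℂ) (A : Op d) :
    ptranspose S (localMap K A) = localMap (conjOn S K) (ptranspose S A) := by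
  have key : ∀ (a : ∀ v, Fin (r v)) (x y : Cfg d') (u w : Cfg d),
      tensorAll (fun v => K v (a v)) (swapOn S x y) (swapOn S u w) *
          star (tensorAll (fun v => K v (a v)) (swapOn S y x) (swapOn S w u)) =
        tensorAll (fun v => conjOn S K v (a v)) x u *
          star (tensorAll (fun v => conjOn S K v (a v)) y w) := by
    intro a x y u w
    simp only [tensorAll_apply, star_prod, ← Finset.prod_mul_distrib]
    refine Finset.prod_congr rfl fun v _ => ?_
    by_cases hv : v ∈ S
    · simp only [swapOn, conjOn, hv, if_true, Matrix.map_apply, star_star]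
      exact mul_comm _ _
    · simp only [swapOn, conjOn, hv, if_false]
  rw [localMap, localMap, ptranspose_sum]
  refine Finset.sum_congr rfl fun a _ => ?_
  ext x y
  simp only [ptranspose_apply, Matrix.mul_apply, Finset.sum_mul, Matrix.conjTranspose_apply]
  rw [← sum_swapOn S]
  refine Finset.sum_congr rfl fun w _ => Finset.sum_congr rfl fun u _ => ?_
  rw [mul_right_comm, key, mul_right_comm]

theorem IsLOCC.map_add {Λ : Op d → Op d'} (h : IsLOCC d' d Λ) (A B : Op d) :
    Λ (A + B) = Λ A + Λ B := by
  induction h with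
  | done => rfl
  | round d v n mid r K hi hc Λ hΛ ih =>
    simp only [localMap_add, ih, Finset.sum_add_distrib]

theorem IsLOCC.map_sum {Λ : Op d → Op d'} (h : IsLOCC d' d Λ) {ι : Type*} (s : Finset ι)
    (A : ι → Op d) : Λ (∑ i ∈ s, A i) = ∑ i ∈ s, Λ (A i) :=
  _root_.map_sum (AddMonoidHom.mk' Λ h.map_add) A s

theorem IsLOCC.posSemidef {Λ : Op d → Op d'} (h : IsLOCC d' d Λ) {A : Op d}
    (hA : A.PosSemidef) : (Λ A).PosSemidef := by
  induction h with
  | done => exact hA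
  | round d v n mid r K hi hc Λ hΛ ih =>
    exact Matrix.posSemidef_sum _ fun j _ => ih j (posSemidef_localMap _ hA)

theorem IsLOCC.trace_eq {Λ : Op d → Op d'} (h : IsLOCC d' d Λ) (A : Op d) :
    (Λ A).trace = A.trace := by
  induction h with
  | done => rfl
  | round d v n mid r K hi hc Λ hΛ ih =>
    simp only [Matrix.trace_sum, ih, trace_localMap]
    rw [← Matrix.trace_sum, ← Finset.sum_mul,
      sum_tensorAll_eq_one v (fun j w => ∑ a, (K j w a)ᴴ * K j w a) hi hc, Matrix.one_mul]

/-- Conjugating an LOCC protocol with the partial transpose gives another LOCC protocol. -/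
theorem IsLOCC.exists_ptranspose {Λ : Op d → Op d'} (h : IsLOCC d' d Λ) (S : Finset V) :
    ∃ Λ' : Op d → Op d', IsLOCC d' d Λ' ∧
      ∀ A, ptranspose S (Λ A) = Λ' (ptranspose S A) := by
  induction h with
  | done => exact ⟨id, IsLOCC.done, fun _ => rfl⟩
  | round d v n mid r K hi hc Λ hΛ ih =>
    choose Λ' hΛ' hpt using ih
    refine ⟨_, IsLOCC.round d v n mid r (fun j => conjOn S (K j)) (sum_conjOn_eq_one S hi)
      (fun j w hw => ?_) Λ' hΛ', fun A => ?_⟩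
    -- A channel is an instrument with a single outcome.
    · have := sum_conjOn_eq_one S (ι := Unit) (v := w) (K := fun _ => K j)
        (by simpa using hc j w hw)
      simpa using this
    · simp only [ptranspose_sum, hpt, ptranspose_localMap]

end LocalOperations

/-! ### The primal program and the properties of its values -/

section Values

variable {V : Type u} [Fintype V] [DecidableEq V] {d : V → ℕ}

theorem nonempty_cut [Nontrivial V] : Nonempty (Cut V) := by
  obtain ⟨a, b, hab⟩ := exists_pair_ne V
  refine ⟨⟨{a}, Finset.singleton_nonempty a, fun h => hab ?_⟩⟩
  exact (Finset.mem_singleton.mp (h ▸ Finset.mem_univ b)).symm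

theorem isLeast_negativity (S : Finset V) {A : Op d} (hA : A.IsHermitian) :
    IsLeast {t | ∃ X : Op d, X.PosSemidef ∧ (X + ptranspose S A).PosSemidef ∧ t = X.trace.re}
      (negativity S A) := by
  have h := ptranspose_isHermitian S hA
  rw [negativity, dif_pos h]
  convert isLeast_sum_neg_eigenvalues h

theorem mem_primalValues_of_cut (S : Cut V) {A X : Op d} (hA : A.PosSemidef) (hX : X.PosSemidef)
    (h : (X + ptranspose S.1 A).PosSemidef) : X.trace.re ∈ primalValues A := by
  refine ⟨Pi.single S A, Pi.single S X, by simp, fun T => ?_, ?_⟩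
  · by_cases hT : T = S
    · subst hT
      simpa only [Pi.single_eq_same] using ⟨hA, hX, h⟩
    · simp only [Pi.single_eq_of_ne hT]
      refine ⟨.zero, .zero, ?_⟩
      convert Matrix.PosSemidef.zero
      ext x y
      simp [ptranspose_apply]
  · rw [Finset.sum_eq_single S (fun T _ hT => by simp [Pi.single_eq_of_ne hT]) (by simp),
      Pi.single_eq_same]

theorem negativity_mem_primalValues (S : Cut V) {A : Op d} (hA : A.PosSemidef) :
    negativity S.1 A ∈ primalValues A := by
  obtain ⟨X, hX, hXA, hn⟩ := (isLeast_negativity S.1 hA.1).1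
  exact hn ▸ mem_primalValues_of_cut S hA hX hXA

theorem primalValues_nonneg {A : Op d} {t : ℝ} (ht : t ∈ primalValues A) : 0 ≤ t := by
  obtain ⟨R, X, -, h, rfl⟩ := ht
  exact Finset.sum_nonneg fun S _ => re_trace_nonneg (h S).2.1

/-- The constraints are jointly conic in `(ρ, R, X)`. Both convexity and the biseparable case rest
on this. -/
theorem add_smul_mem_primalValues {A B : Op d} {s t a b : ℝ} (hs : s ∈ primalValues A)
    (ht : t ∈ primalValues B) (ha : 0 ≤ a) (hb : 0 ≤ b) :
    a * s + b * t ∈ primalValues (a • A + b • B) := by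
  obtain ⟨R, X, rfl, h, rfl⟩ := hs
  obtain ⟨R', X', rfl, h', rfl⟩ := ht
  refine ⟨fun S => a • R S + b • R' S, fun S => a • X S + b • X' S, ?_, fun S => ⟨?_, ?_, ?_⟩, ?_⟩
  · rw [Finset.smul_sum, Finset.smul_sum, Finset.sum_add_distrib]
  · exact (posSemidef_real_smul (h S).1 ha).add (posSemidef_real_smul (h' S).1 hb)
  · exact (posSemidef_real_smul (h S).2.1 ha).add (posSemidef_real_smul (h' S).2.1 hb)
  · rw [ptranspose_add, ptranspose_smul, ptranspose_smul, add_add_add_comm, ← smul_add,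
      ← smul_add]
    exact (posSemidef_real_smul (h S).2.2 ha).add (posSemidef_real_smul (h' S).2.2 hb)
  · simp only [Matrix.trace_add, Complex.add_re, re_trace_smul, Finset.sum_add_distrib,
      Finset.mul_sum]

theorem decompositionValues_subset_primalValues (A : Op d) :
    decompositionValues A ⊆ primalValues A := by
  rintro _ ⟨p, σ, hA, hp, hσ, rfl⟩
  choose X hX hXσ hn using fun S => (isLeast_negativity S.1 (hσ S).1.1).1
  refine ⟨fun S => p S • σ S, fun S => p S • X S, hA, fun S => ⟨?_, ?_, ?_⟩, ?_⟩
  · exact posSemidef_real_smul (hσ S).1 (hp S)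
  · exact posSemidef_real_smul (hX S) (hp S)
  · rw [ptranspose_smul, ← smul_add]
    exact posSemidef_real_smul (hXσ S) (hp S)
  · simp only [hn, re_trace_smul]

/-- Normalizing `R S` by its trace gives `σ S`; the rescaled `X S` bounds its negativity, so the
value can only drop. -/
theorem exists_decompositionValues_le {A : Op d} (hA : IsState A) {t : ℝ}
    (ht : t ∈ primalValues A) : ∃ t' ∈ decompositionValues A, t' ≤ t := by
  obtain ⟨R, X, hR, h, rfl⟩ := ht
  have hp : ∀ S, 0 ≤ (R S).trace.re := fun S => re_trace_nonneg (h S).1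
  have key : ∀ S, ∃ σ : Op d, IsState σ ∧ R S = (R S).trace.re • σ ∧
      (R S).trace.re * negativity S.1 σ ≤ (X S).trace.re := by
    intro S
    rcases (hp S).eq_or_lt with h0 | h0
    -- Zero trace forces `R S = 0`; the weight is zero and any state, here `A`, fills the slot.
    · refine ⟨A, hA, ?_, ?_⟩
      · rw [← h0, zero_smul, eq_zero_of_re_trace_eq_zero (h S).1 h0.symm]
      · rw [← h0, zero_mul]
        exact re_trace_nonneg (h S).2.1
    · have hi : 0 ≤ (R S).trace.re⁻¹ := (inv_pos.mpr h0).le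
      have hσ := posSemidef_real_smul (h S).1 hi
      refine ⟨(R S).trace.re⁻¹ • R S, ⟨hσ, ?_⟩, ?_, ?_⟩
      · rw [trace_eq_re hσ, re_trace_smul, inv_mul_cancel₀ h0.ne', Complex.ofReal_one]
      · rw [smul_smul, mul_inv_cancel₀ h0.ne', one_smul]
      · have hle := (isLeast_negativity S.1 hσ.1).2 ⟨(R S).trace.re⁻¹ • X S,
          posSemidef_real_smul (h S).2.1 hi, by
            rw [ptranspose_smul, ← smul_add]
            exact posSemidef_real_smul (h S).2.2 hi, rfl⟩
        rw [re_trace_smul] at hle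
        calc _ ≤ (R S).trace.re * ((R S).trace.re⁻¹ * (X S).trace.re) :=
              mul_le_mul_of_nonneg_left hle h0.le
          _ = _ := by rw [mul_inv_cancel_left₀ h0.ne']
  choose σ hσ hRσ hle using key
  exact ⟨_, ⟨fun S => (R S).trace.re, σ, hR.trans (Finset.sum_congr rfl fun S _ => hRσ S), hp, hσ,
    rfl⟩, Finset.sum_le_sum fun S _ => hle S⟩

theorem isLeast_decompositionValues_iff {A : Op d} (hA : IsState A) {m : ℝ} :
    IsLeast (decompositionValues A) m ↔ IsLeast (primalValues A) m := by
  constructor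
  · refine fun h => ⟨decompositionValues_subset_primalValues A h.1, fun t ht => ?_⟩
    obtain ⟨t', ht', hle⟩ := exists_decompositionValues_le hA ht
    exact (h.2 ht').trans hle
  · intro h
    obtain ⟨t', ht', hle⟩ := exists_decompositionValues_le hA h.1
    have := h.2 (decompositionValues_subset_primalValues A ht')
    exact ⟨le_antisymm hle this ▸ ht',
      fun t ht => h.2 (decompositionValues_subset_primalValues A ht)⟩

/-- `R S` is pushed forward by `Λ`, but `X S` by the conjugated protocol `Λ' S`, which is the map
that acts on `(R S) ^ Γ_S`. -/
theorem IsLOCC.primalValues_subset {d' : V → ℕ} {Λ : Op d → Op d'} (h : IsLOCC d' d Λ)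
    (A : Op d) : primalValues A ⊆ primalValues (Λ A) := by
  rintro _ ⟨R, X, rfl, hRX, rfl⟩
  choose Λ' hΛ' hpt using fun S : Cut V => h.exists_ptranspose S.1
  refine ⟨fun S => Λ (R S), fun S => Λ' S (X S), h.map_sum _ _, fun S => ⟨?_, ?_, ?_⟩, ?_⟩
  · exact h.posSemidef (hRX S).1
  · exact (hΛ' S).posSemidef (hRX S).2.1
  · rw [hpt, ← (hΛ' S).map_add]
    exact (hΛ' S).posSemidef (hRX S).2.2
  · simp only [(hΛ' _).trace_eq]

theorem IsLOCC.isState {d' : V → ℕ} {Λ : Op d → Op d'} (h : IsLOCC d' d Λ) {A : Op d}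
    (hA : IsState A) : IsState (Λ A) :=
  ⟨h.posSemidef hA.1, (h.trace_eq A).trans hA.2⟩

theorem convex_setOf_isState {n : Type*} [Fintype n] :
    Convex ℝ {A : Matrix n n ℂ | IsState A} := by
  intro A hA B hB a b ha hb hab
  refine ⟨(posSemidef_real_smul hA.1 ha).add (posSemidef_real_smul hB.1 hb), ?_⟩
  rw [Matrix.trace_add, Matrix.trace_smul, Matrix.trace_smul, hA.2, hB.2, ← add_smul, hab,
    one_smul]

theorem convex_setOf_isState_zero_mem_primalValues :
    Convex ℝ {A : Op d | IsState A ∧ 0 ∈ primalValues A} := by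
  intro A hA B hB a b ha hb hab
  refine ⟨convex_setOf_isState hA.1 hB.1 ha hb hab, ?_⟩
  simpa using add_smul_mem_primalValues hA.2 hB.2 ha hb

section Tensor

variable (S : Finset V)
  (A : Matrix (∀ v : {v // v ∈ S}, Fin (d v)) (∀ v : {v // v ∈ S}, Fin (d v)) ℂ)
  (B : Matrix (∀ v : {v // v ∉ S}, Fin (d v)) (∀ v : {v // v ∉ S}, Fin (d v)) ℂ)

theorem ptranspose_tensorAcross :
    ptranspose S (tensorAcross S A B) = tensorAcross S Aᵀ B := by
  ext x y
  rw [ptranspose_apply]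
  simp only [tensorAcross, Matrix.of_apply, Matrix.transpose_apply]
  congr 2 <;> funext v <;> simp [swapOn, v.2]

theorem trace_tensorAcross : (tensorAcross S A B).trace = A.trace * B.trace := by
  simp only [Matrix.trace, Matrix.diag_apply]
  rw [Finset.sum_mul_sum, ← Fintype.sum_prod_type']
  exact Fintype.sum_equiv (Equiv.piEquivPiSubtypeProd (· ∈ S) fun v => Fin (d v)) _ _
    fun _ => rfl

variable {A B}

theorem posSemidef_tensorAcross (hA : A.PosSemidef) (hB : B.PosSemidef) :
    (tensorAcross S A B).PosSemidef :=
  (hA.kronecker hB).submatrix fun x : Cfg d =>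
    ((fun v : {v // v ∈ S} => x v), (fun v : {v // v ∉ S} => x v))

end Tensor

/-- Partial transposition of a product only transposes one positive factor, so `X = 0` is feasible;
mixtures follow by convexity. -/
theorem IsSeparableAcross.isState_and_zero_mem_primalValues {S : Cut V} {A : Op d}
    (h : IsSeparableAcross S.1 A) : IsState A ∧ 0 ∈ primalValues A := by
  refine convexHull_min ?_ convex_setOf_isState_zero_mem_primalValues h
  rintro _ ⟨B, C, hB, hC, rfl⟩
  have hpsd := posSemidef_tensorAcross S.1 hB.1 hC.1
  refine ⟨⟨hpsd, by rw [trace_tensorAcross, hB.2, hC.2, one_mul]⟩, ?_⟩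
  have := mem_primalValues_of_cut S hpsd Matrix.PosSemidef.zero (by
    rw [zero_add, ptranspose_tensorAcross]
    exact posSemidef_tensorAcross S.1 hB.1.transpose hC.1)
  simpa using this

theorem IsBiseparable.isState_and_zero_mem_primalValues {A : Op d} (h : IsBiseparable A) :
    IsState A ∧ 0 ∈ primalValues A := by
  refine convexHull_min ?_ convex_setOf_isState_zero_mem_primalValues h
  rintro σ ⟨S, hσ⟩
  exact hσ.isState_and_zero_mem_primalValues

theorem eq_or_eq_compl_of_card_eq_two (hV : Fintype.card V = 2) (S T : Cut V) :
    T.1 = S.1 ∨ T.1 = S.1ᶜ := by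
  have hcard : ∀ U : Cut V, U.1.card = 1 := by
    intro U
    have h1 := Finset.card_pos.mpr U.2.1
    have h2 := (Finset.card_lt_iff_ne_univ U.1).mpr U.2.2
    omega
  by_cases h : T.1 = S.1
  · exact Or.inl h
  · right
    obtain ⟨a, ha⟩ := Finset.card_eq_one.mp (hcard S)
    obtain ⟨b, hb⟩ := Finset.card_eq_one.mp (hcard T)
    refine Finset.eq_of_subset_of_card_le ?_ ?_
    · rw [ha, hb] at h
      rw [ha, hb]
      simpa [eq_comm] using h
    · rw [Finset.card_compl, hV, hcard S, hcard T]

/-- Transposing `X T` when `T` is the complement of `S` makes every constraint refer to `S`; the sum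
is then feasible for the single cut. -/
theorem negativity_le_of_card_eq_two (hV : Fintype.card V = 2) (S : Cut V) {A : Op d}
    (hA : A.IsHermitian) {t : ℝ} (ht : t ∈ primalValues A) : negativity S.1 A ≤ t := by
  obtain ⟨R, X, rfl, h, rfl⟩ := ht
  have key : ∀ T, ∃ Y : Op d, Y.PosSemidef ∧ (Y + ptranspose S.1 (R T)).PosSemidef ∧
      Y.trace = (X T).trace := by
    intro T
    rcases eq_or_eq_compl_of_card_eq_two hV S T with hT | hT
    · exact ⟨X T, (h T).2.1, hT ▸ (h T).2.2, rfl⟩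
    · refine ⟨(X T)ᵀ, (h T).2.1.transpose, ?_, Matrix.trace_transpose _⟩
      have := (h T).2.2.transpose
      rwa [hT, ptranspose_compl, Matrix.transpose_add, Matrix.transpose_transpose] at this
  choose Y hY hYR htr using key
  refine (isLeast_negativity S.1 hA).2 ⟨∑ T, Y T, Matrix.posSemidef_sum _ fun T _ => hY T, ?_, ?_⟩
  · rw [ptranspose_sum, ← Finset.sum_add_distrib]
    exact Matrix.posSemidef_sum _ fun T _ => hYR T
  · rw [re_trace_sum]
    simp only [htr]

/-- Weak duality: for each cut, add the nonnegative pairings of `W - Q ^ Γ` with `R`, of `Q` with `X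
+ R ^ Γ`, and of `1 - Q` with `X`. -/
theorem DualFeasible.le_primal {A W : Op d} {Q : Cut V → Op d} (hWQ : DualFeasible W Q) {t : ℝ}
    (ht : t ∈ primalValues A) : -(W * A).trace.re ≤ t := by
  obtain ⟨R, X, rfl, h, rfl⟩ := ht
  rw [Finset.mul_sum, re_trace_sum, ← Finset.sum_neg_distrib]
  refine Finset.sum_le_sum fun S _ => ?_
  have h1 := re_trace_mul_nonneg (hWQ S).2.2 (h S).1
  have h2 := re_trace_mul_nonneg (hWQ S).1 (h S).2.2
  have h3 := re_trace_mul_nonneg (hWQ S).2.1 (h S).2.1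
  rw [Matrix.sub_mul, Matrix.trace_sub, Complex.sub_re] at h1 h3
  rw [trace_ptranspose_mul] at h1
  rw [Matrix.mul_add, Matrix.trace_add, Complex.add_re] at h2
  rw [Matrix.one_mul] at h3
  linarith

theorem exists_dualStrictlyFeasible :
    ∃ (W : Op d) (Q : Cut V → Op d), DualStrictlyFeasible W Q := by
  have h : ((1 / 2 : ℝ) • (1 : Op d)).PosDef := Matrix.PosDef.one.smul (by norm_num)
  have h' : (1 : Op d) - (1 / 2 : ℝ) • 1 = (1 / 2 : ℝ) • 1 := by
    rw [sub_eq_iff_eq_add, ← add_smul]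
    norm_num
  refine ⟨1, fun _ => (1 / 2 : ℝ) • 1, fun S => ⟨h, ?_, ?_⟩⟩
  · rwa [h']
  · rwa [ptranspose_smul, ptranspose_one, h']

end Values

/-! ### Closed images and separation from cones -/

/-- The image of a set with compact sublevel sets is closed. -/
theorem isClosed_image_of_isCompact_sublevel {X Y : Type*} [TopologicalSpace X]
    [TopologicalSpace Y] [T2Space Y] {K : Set X} {L : X → Y} (hL : Continuous L) {g : Y → ℝ}
    (hg : Continuous g) (h : ∀ r, IsCompact (K ∩ {x | g (L x) ≤ r})) : IsClosed (L '' K) := by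
  refine isClosed_of_closure_subset fun y hy => ?_
  have hU : IsOpen {z | g z < g y + 1} := isOpen_Iio.preimage hg
  have h1 : y ∈ closure ({z | g z < g y + 1} ∩ L '' K) :=
    hU.inter_closure ⟨lt_add_one (g y), hy⟩
  have h2 : {z | g z < g y + 1} ∩ L '' K ⊆ L '' (K ∩ {x | g (L x) ≤ g y + 1}) := by
    rintro _ ⟨hz, x, hx, rfl⟩
    have hlt : g (L x) < g y + 1 := hz
    exact ⟨x, ⟨hx, hlt.le⟩, rfl⟩
  have h3 := closure_minimal h2 ((h _).image hL).isClosed h1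
  exact Set.image_mono Set.inter_subset_left h3

/-- A closed convex cone is separated from a point outside of it by a functional that is
nonnegative on the cone and negative at the point. -/
theorem exists_separating_functional {E : Type*} [AddCommGroup E] [Module ℝ E]
    [TopologicalSpace E] [IsTopologicalAddGroup E] [ContinuousSMul ℝ E] [LocallyConvexSpace ℝ E]
    {C : Set E} (hconv : Convex ℝ C) (hclosed : IsClosed C)
    (hcone : ∀ c : ℝ, 0 ≤ c → ∀ x ∈ C, c • x ∈ C) (hne : C.Nonempty) {x : E} (hx : x ∉ C) :
    ∃ f : E →ₗ[ℝ] ℝ, f x < 0 ∧ ∀ y ∈ C, 0 ≤ f y := by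
  obtain ⟨f, u, hfx, hf⟩ := geometric_hahn_banach_point_closed hconv hclosed hx
  have hu : u < 0 := by
    obtain ⟨y, hy⟩ := hne
    simpa using hf _ (hcone 0 le_rfl y hy)
  refine ⟨f.toLinearMap, hfx.trans hu, fun y hy => ?_⟩
  by_contra! hneg
  have hneg : f y < 0 := hneg
  -- Rescaled so that `f` takes exactly the value `u`, which it must strictly exceed on the cone.
  have := hf _ (hcone (u / f y) (div_nonneg_of_nonpos hu.le hneg.le) y hy)
  rw [map_smul, smul_eq_mul, div_mul_cancel₀ _ hneg.ne] at this
  exact lt_irrefl _ this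

/-! ### Conic form of the program, strong duality and attainment -/

section Duality

variable {V : Type u} [Fintype V] [DecidableEq V] {d : V → ℕ}

instance {m k : Type*} : LocallyConvexSpace ℝ (Matrix m k ℂ) :=
  inferInstanceAs (LocallyConvexSpace ℝ (m → k → ℂ))

/-- The points `(R, X, P, s)` with positive semidefinite operators `R S`, `X S`, `P S` and
`s ≥ 0`. -/
def sdpOrthant (d : V → ℕ) : Set ((Cut V → Op d) × (Cut V → Op d) × (Cut V → Op d) × ℝ) :=
  {z | (∀ S, (z.1 S).PosSemidef ∧ (z.2.1 S).PosSemidef ∧ (z.2.2.1 S).PosSemidef) ∧ 0 ≤ z.2.2.2}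

/-- The constraint map of the primal program in standard form, with slack variables `P` and
`s`. -/
def sdpMap (d : V → ℕ) : ((Cut V → Op d) × (Cut V → Op d) × (Cut V → Op d) × ℝ) →ₗ[ℝ]
    Op d × (Cut V → Op d) × ℝ where
  toFun z := (∑ S, z.1 S, fun S => z.2.1 S + ptranspose S.1 (z.1 S) - z.2.2.1 S,
    ∑ S, (z.2.1 S).trace.re + z.2.2.2)
  map_add' z w := by
    refine Prod.ext ?_ (Prod.ext (funext fun S => ?_) ?_)
    · simp [Finset.sum_add_distrib]
    · simp only [Prod.fst_add, Prod.snd_add, Pi.add_apply, ptranspose_add]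
      abel
    · simp only [Prod.fst_add, Prod.snd_add, Pi.add_apply, Matrix.trace_add, Complex.add_re,
        Finset.sum_add_distrib]
      ring
  map_smul' c z := by
    refine Prod.ext ?_ (Prod.ext (funext fun S => ?_) ?_)
    · simp [Finset.smul_sum]
    · simp only [Prod.smul_fst, Prod.smul_snd, Pi.smul_apply, ptranspose_smul, smul_add, smul_sub,
        RingHom.id_apply]
    · simp only [Prod.smul_fst, Prod.smul_snd, Pi.smul_apply, re_trace_smul, ← Finset.mul_sum,
        RingHom.id_apply, smul_eq_mul, mul_add]

/-- The cone of all right-hand sides for which the primal program in standard form is feasible. -/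
def sdpCone (d : V → ℕ) : Set (Op d × (Cut V → Op d) × ℝ) := sdpMap d '' sdpOrthant d

theorem sdpMap_apply (z : (Cut V → Op d) × (Cut V → Op d) × (Cut V → Op d) × ℝ) :
    sdpMap d z = (∑ S, z.1 S, fun S => z.2.1 S + ptranspose S.1 (z.1 S) - z.2.2.1 S,
      ∑ S, (z.2.1 S).trace.re + z.2.2.2) := rfl

theorem continuous_sdpMap : Continuous (sdpMap d) := by
  refine Continuous.prodMk ?_ (Continuous.prodMk (continuous_pi fun S => ?_) ?_)
  · fun_prop
  · have := (continuous_ptranspose (d := d) S.1).comp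
      ((continuous_apply S).comp
        (continuous_fst (X := Cut V → Op d) (Y := (Cut V → Op d) × (Cut V → Op d) × ℝ)))
    exact Continuous.sub (Continuous.add (by fun_prop) this) (by fun_prop)
  · refine Continuous.add (continuous_finsetSum _ fun S _ => ?_) (by fun_prop)
    exact continuous_re_trace.comp (by fun_prop)

theorem isClosed_sdpOrthant : IsClosed (sdpOrthant d) := by
  have h : sdpOrthant d = (⋂ S, ((fun z => z.1 S) ⁻¹' {A | A.PosSemidef} ∩
      ((fun z => z.2.1 S) ⁻¹' {A | A.PosSemidef} ∩
        (fun z => z.2.2.1 S) ⁻¹' {A | A.PosSemidef}))) ∩ {z | 0 ≤ z.2.2.2} := by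
    ext z
    simp [sdpOrthant]
  rw [h]
  refine (isClosed_iInter fun S => ?_).inter (isClosed_le continuous_const (by fun_prop))
  exact (isClosed_setOf_posSemidef.preimage (by fun_prop)).inter
    ((isClosed_setOf_posSemidef.preimage (by fun_prop)).inter
      (isClosed_setOf_posSemidef.preimage (by fun_prop)))

theorem isClosed_sdpCone : IsClosed (sdpCone d) := by
  refine isClosed_image_of_isCompact_sublevel continuous_sdpMap
    -- Chosen so that along `sdpMap` it becomes the sum of all traces of `R`, `X`, `P` plus `2 * s`,
    -- which bounds every component on the orthant.
    (g := fun y => 2 * y.1.trace.re + 2 * y.2.2 - ∑ S, (y.2.1 S).trace.re) ?_ fun r => ?_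
  · refine Continuous.sub (Continuous.add ?_ ?_) (continuous_finsetSum _ fun S _ => ?_)
    · exact continuous_const.mul (continuous_re_trace.comp continuous_fst)
    · fun_prop
    · exact continuous_re_trace.comp (by fun_prop)
  have hg : ∀ z : (Cut V → Op d) × (Cut V → Op d) × (Cut V → Op d) × ℝ,
      2 * (sdpMap d z).1.trace.re + 2 * (sdpMap d z).2.2 -
        ∑ S, ((sdpMap d z).2.1 S).trace.re =
      ∑ S, (z.1 S).trace.re + ∑ S, (z.2.1 S).trace.re + ∑ S, (z.2.2.1 S).trace.re +
        2 * z.2.2.2 := by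
    intro z
    simp only [sdpMap_apply, re_trace_sum, Matrix.trace_add, Matrix.trace_sub, trace_ptranspose,
      Complex.add_re, Complex.sub_re, Finset.sum_add_distrib, Finset.sum_sub_distrib]
    ring
  have hcompact : IsCompact (Set.pi Set.univ fun _ : Cut V =>
      {A : Op d | A.PosSemidef ∧ A.trace.re ≤ r}) :=
    isCompact_univ_pi fun _ => isCompact_setOf_posSemidef_trace_le r
  refine (hcompact.prod (hcompact.prod (hcompact.prod
    (isCompact_Icc (a := (0 : ℝ)) (b := r))))).of_isClosed_subset ?_ ?_
  · simp only [hg]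
    refine isClosed_sdpOrthant.inter (isClosed_le (Continuous.add (Continuous.add
      (Continuous.add ?_ ?_) ?_) ?_) continuous_const)
    · exact continuous_finsetSum _ fun S _ => continuous_re_trace.comp (by fun_prop)
    · exact continuous_finsetSum _ fun S _ => continuous_re_trace.comp (by fun_prop)
    · exact continuous_finsetSum _ fun S _ => continuous_re_trace.comp (by fun_prop)
    · fun_prop
  · rintro z ⟨⟨hz, hs⟩, hr⟩
    rw [Set.mem_ofPred_eq, hg] at hr
    have h1 : ∀ S, 0 ≤ (z.1 S).trace.re := fun S => re_trace_nonneg (hz S).1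
    have h2 : ∀ S, 0 ≤ (z.2.1 S).trace.re := fun S => re_trace_nonneg (hz S).2.1
    have h3 : ∀ S, 0 ≤ (z.2.2.1 S).trace.re := fun S => re_trace_nonneg (hz S).2.2
    have h1' := Finset.sum_nonneg fun S (_ : S ∈ Finset.univ) => h1 S
    have h2' := Finset.sum_nonneg fun S (_ : S ∈ Finset.univ) => h2 S
    have h3' := Finset.sum_nonneg fun S (_ : S ∈ Finset.univ) => h3 S
    refine ⟨fun S _ => ⟨(hz S).1, ?_⟩, fun S _ => ⟨(hz S).2.1, ?_⟩, fun S _ => ⟨(hz S).2.2, ?_⟩,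
      hs, ?_⟩
    · have := Finset.single_le_sum (fun T _ => h1 T) (Finset.mem_univ S)
      linarith
    · have := Finset.single_le_sum (fun T _ => h2 T) (Finset.mem_univ S)
      linarith
    · have := Finset.single_le_sum (fun T _ => h3 T) (Finset.mem_univ S)
      linarith
    · linarith

theorem smul_mem_sdpOrthant {c : ℝ} (hc : 0 ≤ c)
    {z : (Cut V → Op d) × (Cut V → Op d) × (Cut V → Op d) × ℝ} (hz : z ∈ sdpOrthant d) :
    c • z ∈ sdpOrthant d :=
  ⟨fun S => ⟨posSemidef_real_smul (hz.1 S).1 hc, posSemidef_real_smul (hz.1 S).2.1 hc,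
    posSemidef_real_smul (hz.1 S).2.2 hc⟩, mul_nonneg hc hz.2⟩

theorem smul_mem_sdpCone {c : ℝ} (hc : 0 ≤ c) {y : Op d × (Cut V → Op d) × ℝ}
    (hy : y ∈ sdpCone d) : c • y ∈ sdpCone d := by
  obtain ⟨z, hz, rfl⟩ := hy
  exact ⟨c • z, smul_mem_sdpOrthant hc hz, map_smul _ _ _⟩

theorem convex_sdpCone : Convex ℝ (sdpCone d) := by
  refine Convex.linear_image (fun z hz w hw a b ha hb _ => ?_) (sdpMap d)
  have hz := smul_mem_sdpOrthant ha hz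
  have hw := smul_mem_sdpOrthant hb hw
  exact ⟨fun S => ⟨(hz.1 S).1.add (hw.1 S).1, (hz.1 S).2.1.add (hw.1 S).2.1,
    (hz.1 S).2.2.add (hw.1 S).2.2⟩, add_nonneg hz.2 hw.2⟩

/-- The zero component forces `P S = X S + (R S) ^ Γ_S`, and the slack `s` turns equality of values
into `≤`. -/
theorem mem_sdpCone_iff {A : Op d} {t : ℝ} :
    (A, 0, t) ∈ sdpCone d ↔ ∃ t' ∈ primalValues A, t' ≤ t := by
  constructor
  · rintro ⟨⟨R, X, P, s⟩, ⟨hz, hs⟩, h⟩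
    rw [sdpMap_apply, Prod.mk.injEq, Prod.mk.injEq] at h
    obtain ⟨h1, h2, h3⟩ := h
    refine ⟨_, ⟨R, X, h1.symm, fun S => ⟨(hz S).1, (hz S).2.1, ?_⟩, rfl⟩, ?_⟩
    · rw [sub_eq_zero.mp (congrFun h2 S)]
      exact (hz S).2.2
    · dsimp only at h3 hs
      linarith
  · rintro ⟨_, ⟨R, X, rfl, h, rfl⟩, hle⟩
    refine ⟨(R, X, fun S => X S + ptranspose S.1 (R S), t - ∑ S, (X S).trace.re),
      ⟨h, sub_nonneg.mpr hle⟩, ?_⟩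
    rw [sdpMap_apply]
    refine Prod.ext rfl (Prod.ext (funext fun S => sub_self _) ?_)
    exact add_sub_cancel _ _

theorem exists_isLeast_primalValues {A : Op d} (hne : (primalValues A).Nonempty) :
    ∃ m, IsLeast (primalValues A) m := by
  set T : Set ℝ := {t | (A, 0, t) ∈ sdpCone d} with hT
  have hclosed : IsClosed T := isClosed_sdpCone.preimage (by fun_prop)
  have hsub : primalValues A ⊆ T := fun t ht => mem_sdpCone_iff.mpr ⟨t, ht, le_rfl⟩
  have hbdd : BddBelow T := by
    refine ⟨0, fun t ht => ?_⟩
    obtain ⟨t', ht', hle⟩ := mem_sdpCone_iff.mp ht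
    exact (primalValues_nonneg ht').trans hle
  obtain ⟨m, hm, hle⟩ := mem_sdpCone_iff.mp (hclosed.csInf_mem (hne.mono hsub) hbdd)
  exact ⟨m, hm, fun t ht => hle.trans (csInf_le hbdd (hsub ht))⟩

theorem exists_dualFeasible_lt {A : Op d} (hA : A.IsHermitian) {m t : ℝ}
    (hm : IsLeast (primalValues A) m) (ht : t < m) :
    ∃ (W : Op d) (Q : Cut V → Op d), DualFeasible W Q ∧ t < -(W * A).trace.re := by
  have hmem : (A, 0, m) ∈ sdpCone d := mem_sdpCone_iff.mpr ⟨m, hm.1, le_rfl⟩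
  have hnot : (A, 0, t) ∉ sdpCone d := fun h => by
    obtain ⟨t', ht', hle⟩ := mem_sdpCone_iff.mp h
    exact absurd (hm.2 ht') (by linarith)
  obtain ⟨f, hneg, hpos⟩ := exists_separating_functional convex_sdpCone isClosed_sdpCone
    (fun c hc y hy => smul_mem_sdpCone hc hy) ⟨_, hmem⟩ hnot
  set c : ℝ := f (0, 0, 1) with hc
  have hf3 : ∀ s : ℝ, f (0, 0, s) = s * c := by
    intro s
    rw [hc, ← smul_eq_mul, ← map_smul]
    simp
  have hsplit : ∀ (B : Op d) (Y : Cut V → Op d) (s : ℝ),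
      f (B, Y, s) = f (B, 0, 0) + f (0, Y, 0) + s * c := by
    intro B Y s
    rw [← hf3, ← map_add, ← map_add]
    simp
  have hf0 : f (0, 0, 0) = 0 := map_zero f
  -- Between the separated point and the cone point `(A, 0, m)`, `f` rises by `(m - t) * c`, so the
  -- objective has positive weight and can be normalized.
  have hc0 : 0 < c := by
    have h1 := hpos _ hmem
    rw [hsplit] at h1 hneg
    nlinarith
  obtain ⟨W, hW, hfW⟩ := exists_isHermitian_re_trace_mul
    (c⁻¹ • f ∘ₗ LinearMap.inl ℝ (Op d) ((Cut V → Op d) × ℝ))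
  -- The sign makes `f / c` equal to `Tr (W B) - ∑ S, Tr (Q S * Y S) + s` on Hermitian arguments.
  choose Q hQ hfQ using fun S : Cut V => exists_isHermitian_re_trace_mul
    (-(c⁻¹ • f ∘ₗ LinearMap.inr ℝ (Op d) ((Cut V → Op d) × ℝ) ∘ₗ
      LinearMap.inl ℝ (Cut V → Op d) ℝ ∘ₗ LinearMap.single ℝ (fun _ : Cut V => Op d) S))
  have hfW' : ∀ B : Op d, B.IsHermitian → f (B, 0, 0) = c * (W * B).trace.re := by
    intro B hB
    rw [← hfW B hB]
    exact (mul_inv_cancel_left₀ hc0.ne' _).symm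
  have hfQ' : ∀ (S : Cut V) (B : Op d), B.IsHermitian →
      f (0, Pi.single S B, 0) = -(c * (Q S * B).trace.re) := by
    intro S B hB
    rw [← hfQ S B hB]
    simp [hc0.ne']
  have hcone : ∀ (S : Cut V) (R X P : Op d), R.PosSemidef → X.PosSemidef → P.PosSemidef →
      0 ≤ (W * R).trace.re - (Q S * (X + ptranspose S.1 R - P)).trace.re + X.trace.re := by
    intro S R X P hR hX hP
    have hsingle : ∀ (B : Op d) (T : Cut V), B.PosSemidef →
        ((Pi.single S B : Cut V → Op d) T).PosSemidef := by
      intro B T hB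
      by_cases hT : T = S
      · rw [hT, Pi.single_eq_same]
        exact hB
      · rw [Pi.single_eq_of_ne hT]
        exact .zero
    have h := hpos _ ⟨(Pi.single S R, Pi.single S X, Pi.single S P, 0),
      ⟨fun T => ⟨hsingle R T hR, hsingle X T hX, hsingle P T hP⟩, le_rfl⟩, rfl⟩
    have heq : sdpMap d (Pi.single S R, Pi.single S X, Pi.single S P, 0) =
        (R, Pi.single S (X + ptranspose S.1 R - P), X.trace.re) := by
      rw [sdpMap_apply]
      refine Prod.ext (by simp) (Prod.ext (funext fun T => ?_) ?_)
      · by_cases hT : T = S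
        · subst hT
          simp only [Pi.single_eq_same]
        · simp only [Pi.single_eq_of_ne hT]
          ext x y
          simp [ptranspose_apply]
      · dsimp only
        rw [add_zero, Finset.sum_eq_single S (fun T _ hT => by simp [Pi.single_eq_of_ne hT])
          (by simp), Pi.single_eq_same]
    rw [heq, hsplit, hfW' R hR.1,
      hfQ' S _ ((hX.1.add (ptranspose_isHermitian S.1 hR.1)).sub hP.1)] at h
    refine nonneg_of_mul_nonneg_right (b := _) (a := c) ?_ hc0
    linarith
  -- Testing `hcone` with only `P`, only `X`, or only `R` nonzero yields the three dual constraints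
  -- in turn.
  refine ⟨W, Q, fun S => ⟨?_, ?_, ?_⟩, ?_⟩
  · refine posSemidef_of_forall_re_trace_mul_nonneg (hQ S) fun B hB => ?_
    have := hcone S 0 0 B .zero .zero hB
    rwa [ptranspose_zero, Matrix.mul_zero, zero_add, zero_sub, Matrix.mul_neg, Matrix.trace_zero,
      Matrix.trace_neg, Complex.zero_re, Complex.neg_re, sub_neg_eq_add, zero_add, add_zero] at this
  · refine posSemidef_of_forall_re_trace_mul_nonneg (Matrix.isHermitian_one.sub (hQ S))
      fun B hB => ?_
    have := hcone S 0 B 0 .zero hB .zero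
    rw [ptranspose_zero, Matrix.mul_zero, add_zero, sub_zero, Matrix.trace_zero,
      Complex.zero_re, zero_sub] at this
    rw [Matrix.sub_mul, Matrix.one_mul, Matrix.trace_sub, Complex.sub_re]
    linarith
  · refine posSemidef_of_forall_re_trace_mul_nonneg
      (hW.sub (ptranspose_isHermitian S.1 (hQ S))) fun B hB => ?_
    have := hcone S B 0 0 hB .zero .zero
    rw [zero_add, sub_zero, Matrix.trace_zero, Complex.zero_re, add_zero,
      ← trace_ptranspose_mul] at this
    rwa [Matrix.sub_mul, Matrix.trace_sub, Complex.sub_re]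
  · rw [hsplit, hfW' A hA, hf0] at hneg
    nlinarith

theorem isLUB_dualValues {A : Op d} (hA : A.IsHermitian) {m : ℝ}
    (hm : IsLeast (primalValues A) m) : IsLUB (dualValues A) m := by
  constructor
  · rintro _ ⟨W, Q, hWQ, rfl⟩
    exact hWQ.le_primal hm.1
  · intro b hb
    refine le_of_forall_lt fun t ht => ?_
    obtain ⟨W, Q, hWQ, hlt⟩ := exists_dualFeasible_lt hA hm ht
    exact hlt.trans_le (hb ⟨W, Q, hWQ, rfl⟩)

theorem isClosed_setOf_dualFeasible :
    IsClosed {z : Op d × (Cut V → Op d) | DualFeasible z.1 z.2} := by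
  simp only [DualFeasible, Set.ofPred_forall, Set.ofPred_and]
  refine isClosed_iInter fun S => ?_
  refine (isClosed_setOf_posSemidef.preimage ?_).inter
    ((isClosed_setOf_posSemidef.preimage ?_).inter (isClosed_setOf_posSemidef.preimage ?_))
  · fun_prop
  · fun_prop
  · have : Continuous fun z : Op d × (Cut V → Op d) => ptranspose S.1 (z.2 S) :=
      (continuous_ptranspose S.1).comp (by fun_prop)
    exact continuous_fst.sub this

/-- The `Q S` are bounded by `1`. For one cut, `W - Q ^ Γ` is positive and pairs with `A` to at most
`Tr X - b`, so coercivity bounds its trace and hence `W`. -/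
theorem isCompact_setOf_dualFeasible_ge [Nonempty (Cut V)] {A : Op d} (hA : A.PosDef) (b : ℝ) :
    IsCompact {z : Op d × (Cut V → Op d) | DualFeasible z.1 z.2 ∧ b ≤ -(z.1 * A).trace.re} := by
  obtain ⟨c, hc, hcA⟩ := exists_pos_mul_trace_le hA
  obtain ⟨S₀⟩ := ‹Nonempty (Cut V)›
  obtain ⟨X, hX, hXA, -⟩ := (isLeast_negativity S₀.1 hA.1).1
  set N : ℝ := (1 : Op d).trace.re with hN
  have hQN : ∀ {W : Op d} {Q : Cut V → Op d}, DualFeasible W Q → ∀ S, (Q S).trace.re ≤ N := by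
    intro W Q h S
    have := re_trace_nonneg (h S).2.1
    rw [Matrix.trace_sub, Complex.sub_re] at this
    linarith
  refine ((isCompact_setOf_norm_apply_le ((X.trace.re - b) / c + N)).prod
    (isCompact_univ_pi fun _ : Cut V => isCompact_setOf_posSemidef_trace_le (n := Cfg d) N)
    ).of_isClosed_subset ?_ ?_
  · have hcont : Continuous fun z : Op d × (Cut V → Op d) => -(z.1 * A).trace.re :=
      (continuous_re_trace.comp (by fun_prop)).neg
    exact isClosed_setOf_dualFeasible.inter (isClosed_le continuous_const hcont)
  · rintro ⟨W, Q⟩ ⟨h, hb⟩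
    dsimp only at h hb
    refine ⟨fun i j => ?_, fun S _ => ⟨(h S).1, hQN h S⟩⟩
    have h1 := hcA _ (h S₀).2.2
    have h2 := re_trace_mul_nonneg (h S₀).1 hXA
    have h3 := re_trace_mul_nonneg (h S₀).2.1 hX
    rw [Matrix.sub_mul W, Matrix.trace_sub (W * A), Complex.sub_re, trace_ptranspose_mul] at h1
    rw [Matrix.mul_add, Matrix.trace_add, Complex.add_re] at h2
    rw [Matrix.sub_mul, Matrix.one_mul, Matrix.trace_sub, Complex.sub_re] at h3
    have h4 : (W - ptranspose S₀.1 (Q S₀)).trace.re ≤ (X.trace.re - b) / c := by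
      rw [le_div_iff₀ hc]
      linarith
    have h5 := norm_apply_le_re_trace (h S₀).2.2 i j
    have h6 := norm_apply_le_re_trace (h S₀).1 (swapOn S₀.1 i j) (swapOn S₀.1 j i)
    have h7 := hQN h S₀
    calc ‖W i j‖ = ‖(W - ptranspose S₀.1 (Q S₀)) i j + ptranspose S₀.1 (Q S₀) i j‖ := by
          rw [Matrix.sub_apply, sub_add_cancel]
      _ ≤ _ := (norm_add_le _ _).trans (add_le_add (h5.trans h4) (h6.trans h7))

theorem isGreatest_dualValues [Nonempty (Cut V)] {A : Op d} (hA : A.PosDef) {m : ℝ}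
    (hm : IsLUB (dualValues A) m) : IsGreatest (dualValues A) m := by
  refine ⟨?_, hm.1⟩
  obtain ⟨_, ⟨W₀, Q₀, h₀, rfl⟩, hlt, -⟩ := hm.exists_between (sub_one_lt m)
  have hcont : Continuous fun z : Op d × (Cut V → Op d) => -(z.1 * A).trace.re :=
    (continuous_re_trace.comp (by fun_prop)).neg
  obtain ⟨⟨W, Q⟩, hWQ, hmax⟩ :=
    (isCompact_setOf_dualFeasible_ge hA (-(W₀ * A).trace.re)).exists_isMaxOn
      ⟨(W₀, Q₀), h₀, le_rfl⟩ hcont.continuousOn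
  rw [isMaxOn_iff] at hmax
  refine ⟨W, Q, hWQ.1, le_antisymm (hm.2 ?_) (hm.1 ⟨W, Q, hWQ.1, rfl⟩)⟩
  rintro _ ⟨W', Q', h', rfl⟩
  -- Points below the starting value lie outside the compact set but are dominated by the starting
  -- point.
  rcases le_total (-(W₀ * A).trace.re) (-(W' * A).trace.re) with h | h
  · exact hmax (W', Q') ⟨h', h⟩
  · exact h.trans (hmax (W₀, Q₀) ⟨h₀, le_rfl⟩)

end Duality

/-! ### Assembly -/

section Main

variable {V : Type u} [Fintype V] [DecidableEq V] {d : V → ℕ}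

theorem isLeast_primalValues_gmeNegativity [Nonempty (Cut V)] {A : Op d} (hA : IsState A) :
    IsLeast (primalValues A) (gmeNegativity A) := by
  obtain ⟨m, hm⟩ := exists_isLeast_primalValues
    ⟨_, negativity_mem_primalValues (Classical.arbitrary (Cut V)) hA.1⟩
  rwa [gmeNegativity, ((isLeast_decompositionValues_iff hA).mpr hm).csInf_eq]

end Main

end GME

theorem mainTheorem11 {V : Type*} [Fintype V] [DecidableEq V] [Nontrivial V] (d : V → ℕ) :
    -- the minimum defining the GME negativity is attained
    (∀ ρ : GME.Op d, GME.IsState ρ →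
      IsLeast (GME.decompositionValues ρ) (GME.gmeNegativity ρ)) ∧
    -- it vanishes on biseparable states
    (∀ ρ : GME.Op d, GME.IsBiseparable ρ → GME.gmeNegativity ρ = 0) ∧
    -- it does not increase under LOCC
    (∀ (d' : V → ℕ) (Λ : GME.Op d → GME.Op d'), GME.IsLOCC d' d Λ →
      ∀ ρ : GME.Op d, GME.IsState ρ →
        GME.IsState (Λ ρ) ∧ GME.gmeNegativity (Λ ρ) ≤ GME.gmeNegativity ρ) ∧
    -- it is convex
    ConvexOn ℝ {ρ : GME.Op d | GME.IsState ρ} GME.gmeNegativity ∧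
    -- for two parties it is the bipartite negativity
    (Fintype.card V = 2 → ∀ (S : GME.Cut V) (ρ : GME.Op d), GME.IsState ρ →
      GME.gmeNegativity ρ = GME.negativity S.1 ρ) ∧
    -- Slater's condition: the dual program is strictly feasible
    (∃ (W : GME.Op d) (Q : GME.Cut V → GME.Op d), GME.DualStrictlyFeasible W Q) ∧
    -- strong duality: both programs have the GME negativity as their optimal value
    (∀ ρ : GME.Op d, GME.IsState ρ →
      IsLeast (GME.primalValues ρ) (GME.gmeNegativity ρ) ∧
      IsLUB (GME.dualValues ρ) (GME.gmeNegativity ρ) ∧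
      -- the dual optimum is attained if the state has full rank
      (ρ.PosDef → IsGreatest (GME.dualValues ρ) (GME.gmeNegativity ρ))) := by
  have : Nonempty (GME.Cut V) := GME.nonempty_cut
  -- Stated for all local dimensions, since LOCC may change them.
  have hleast := fun {d : V → ℕ} {ρ : GME.Op d} (hρ : GME.IsState ρ) =>
    GME.isLeast_primalValues_gmeNegativity hρ
  refine ⟨fun ρ hρ => (GME.isLeast_decompositionValues_iff hρ).mpr (hleast hρ), fun ρ hρ => ?_,
    fun d' Λ hΛ ρ hρ => ⟨hΛ.isState hρ, ?_⟩, ⟨GME.convex_setOf_isState, ?_⟩, fun hV S ρ hρ => ?_,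
    GME.exists_dualStrictlyFeasible, fun ρ hρ => ⟨hleast hρ, ?_, fun hpos => ?_⟩⟩
  · obtain ⟨hstate, h0⟩ := hρ.isState_and_zero_mem_primalValues
    exact le_antisymm ((hleast hstate).2 h0) (GME.primalValues_nonneg (hleast hstate).1)
  · exact (hleast (hΛ.isState hρ)).2 (hΛ.primalValues_subset ρ (hleast hρ).1)
  · intro ρ hρ σ hσ a b ha hb hab
    exact (hleast (GME.convex_setOf_isState hρ hσ ha hb hab)).2
      (GME.add_smul_mem_primalValues (hleast hρ).1 (hleast hσ).1 ha hb)
  · exact le_antisymm ((hleast hρ).2 (GME.negativity_mem_primalValues S hρ.1))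
      (GME.negativity_le_of_card_eq_two hV S hρ.1.1 (hleast hρ).1)
  · exact GME.isLUB_dualValues hρ.1.1 (hleast hρ)
  · exact GME.isGreatest_dualValues hpos (GME.isLUB_dualValues hρ.1.1 (hleast hρ))
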